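/- Let $n\ge 1$, $0<\alpha\le 1$, $\mathbb R^n_+=\{x\in\mathbb R^n: x_i\ge 0\ \forall i\}$. For $a,b\ge 0$ put $a\oplus_\alpha b=(a^\alpha+b^\alpha)^{1/\alpha}$, and for $p,x\in\mathbb R^n_+$ put $p\odot_\alpha x=p_1x_1\oplus_\alpha\dots\oplus_\alpha p_nx_n$. Let $\mu$ be a signed Borel measure supported in $\mathbb R^n_+$, with total variation $|\mu|$ finite on compact sets, which is absolutely continuous with a density $a(x)$ that is continuous on $\mathbb R^n_+$. Let $p\in\mathbb R^n_+$, $p\ne 0$, be such that $|\mu|(\{x\in\mathbb R^n_+: p\odot_\alpha x\le s\})<\infty$ for all $s>0$ (this is automatic if $|\mu|$ is finite, or if all $p_i>0$), and let $$R_\alpha[\mu](p,p_0)=\frac{\partial}{\partial p_0}\int_{p\odot_\alpha x\le p_0}\mu(dx),\qquad p_0>0,$$ the derivative being taken in the sense of distributions on $(0,\infty)$. Let $\Omega_\alpha(p)$ be any differential form of degree $n-1$ on the interior of $\mathbb R^n_+$ (no regularity is required) such that $$d_x(p\odot_\alpha x)\wedge\Omega_\alpha(p)=dx_1\wedge\dots\wedge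 dx_n .$$ For $s>0$ let $$F(s)=\int_{p\odot_\alpha x=s}a(x)\,\Omega_\alpha(p)$$ be the integral over the smooth hypersurface $\{x\in\operatorname{int}\mathbb R^n_+: p\odot_\alpha x=s\}$, oriented as a part of the boundary of $\{p\odot_\alpha x\le s\}$ (outward vector first). Then the integral $F(s)$ converges absolutely for almost every $s>0$, $F$ is locally integrable on $(0,\infty)$, and $$R_\alpha[\mu](p,p_0)=\int_{p\odot_\alpha x=p_0}a(x)\,\Omega_\alpha(p)$$ as distributions in $p_0\in(0,\infty)$. If moreover all $p_i>0$, then the integral $F(p_0)$ converges absolutely for every $p_0>0$, $F$ is continuous on $(0,\infty)$, and the equality holds for every $p_0>0$ with the derivative in the definition of $R_\alpha[\mu](p,p_0)$ taken in the classical sense. -/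

import Mathlib

open MeasureTheory Set TopologicalSpace
open scoped Distributions LineDeriv

noncomputable section

namespace CES

/-- The operation `a ⊕_α b = (a^α + b^α)^{1/α}` on nonnegative numbers. -/
def cesAdd (α a b : ℝ) : ℝ := (a ^ α + b ^ α) ^ (1 / α)

/-- The CES function `p ⊙_α x = p₁x₁ ⊕_α p₂x₂ ⊕_α … ⊕_α pₙxₙ`
(`0` is the neutral element of `⊕_α`). -/
def cesProd (α : ℝ) {n : ℕ} (p x : Fin n → ℝ) : ℝ :=
  (List.ofFn fun i => p i * x i).foldr (cesAdd α) 0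

theorem foldr_cesAdd {α : ℝ} (hα : 0 < α) (l : List ℝ) (hl : ∀ y ∈ l, 0 ≤ y) :
    l.foldr (cesAdd α) 0 = ((l.map fun y => y ^ α).sum) ^ (1 / α) := by
  induction l with
  | nil =>
    simp only [List.foldr_nil, List.map_nil, List.sum_nil]
    rw [Real.zero_rpow (one_div_pos.mpr hα).ne']
  | cons y l ih =>
    have hl' : ∀ z ∈ l, 0 ≤ z := fun z hz => hl z (List.mem_cons_of_mem _ hz)
    have hs : 0 ≤ (l.map fun y => y ^ α).sum := by
      apply List.sum_nonneg
      intro z hz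
      obtain ⟨w, hw, rfl⟩ := List.mem_map.mp hz
      exact Real.rpow_nonneg (hl' w hw) α
    rw [List.foldr_cons, ih hl', List.map_cons, List.sum_cons, cesAdd, ← Real.rpow_mul hs,
      one_div_mul_cancel hα.ne', Real.rpow_one]

/-- The closed formula for the CES function on nonnegative vectors. -/
theorem cesProd_eq {α : ℝ} (hα : 0 < α) {n : ℕ} (p x : Fin n → ℝ)
    (hp : ∀ i, 0 ≤ p i) (hx : ∀ i, 0 ≤ x i) :
    cesProd α p x = (∑ i, (p i * x i) ^ α) ^ (1 / α) := by
  rw [cesProd, foldr_cesAdd hα, List.map_ofFn, List.sum_ofFn]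
  · rfl
  · intro y hy
    obtain ⟨i, rfl⟩ := List.mem_ofFn.mp hy
    exact mul_nonneg (hp i) (hx i)

/-- The closed nonnegative orthant `ℝⁿ₊`. -/
def orthant (n : ℕ) : Set (Fin n → ℝ) := {x | ∀ i, 0 ≤ x i}

/-- The open positive orthant, the interior of `ℝⁿ₊`. -/
def openOrthant (n : ℕ) : Set (Fin n → ℝ) := {x | ∀ i, 0 < x i}

/-- The sublevel set `{x ∈ ℝⁿ₊ : p ⊙_α x ≤ s}`. -/
def sublevel (α : ℝ) {n : ℕ} (p : Fin n → ℝ) (s : ℝ) : Set (Fin n → ℝ) :=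
  {x | x ∈ orthant n ∧ cesProd α p x ≤ s}

/-- The level hypersurface `{x ∈ int ℝⁿ₊ : p ⊙_α x = s}`. -/
def levelHypersurface (α : ℝ) {n : ℕ} (p : Fin n → ℝ) (s : ℝ) : Set (Fin n → ℝ) :=
  {x | x ∈ openOrthant n ∧ cesProd α p x = s}

/-- A signed Borel measure on `ℝⁿ` supported in `ℝⁿ₊` whose total variation is finite on compact
sets, given by its Jordan decomposition `μ = μ₊ - μ₋`.  (Mathlib's `SignedMeasure` is the special
case of finite total variation.) -/
structure SignedBorelMeasure (n : ℕ) where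
  pos : Measure (Fin n → ℝ)
  neg : Measure (Fin n → ℝ)
  mutuallySingular : pos ⟂ₘ neg
  pos_finiteOnCompacts : IsFiniteMeasureOnCompacts pos
  neg_finiteOnCompacts : IsFiniteMeasureOnCompacts neg
  pos_compl_orthant : pos (orthant n)ᶜ = 0
  neg_compl_orthant : neg (orthant n)ᶜ = 0

namespace SignedBorelMeasure

variable {n : ℕ}

/-- The total variation `|μ| = μ₊ + μ₋`. -/
def variation (μ : SignedBorelMeasure n) : Measure (Fin n → ℝ) := μ.pos + μ.neg

/-- The value `μ(A) = μ₊(A) - μ₋(A)`, meaningful for Borel sets with `|μ|(A) < ∞`. -/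
def value (μ : SignedBorelMeasure n) (A : Set (Fin n → ℝ)) : ℝ := μ.pos.real A - μ.neg.real A

/-- `μ` is absolutely continuous with density `a` on `ℝⁿ₊`: `μ(A) = ∫_A a(x) dx` for each
Borel set `A ⊆ ℝⁿ₊` of finite total variation. -/
def HasDensity (μ : SignedBorelMeasure n) (a : (Fin n → ℝ) → ℝ) : Prop :=
  ∀ A : Set (Fin n → ℝ), MeasurableSet A → A ⊆ orthant n → μ.variation A < ⊤ →
    IntegrableOn a A ∧ μ.value A = ∫ x in A, a x

end SignedBorelMeasure

/-- The open half-line `(0, ∞)`. -/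
def halfLine : Opens ℝ := ⟨Ioi 0, isOpen_Ioi⟩

/-- The regular distribution `φ ↦ ∫ φ(s) g(s) ds` on `(0, ∞)`, for `g` locally integrable on
`(0, ∞)`. -/
def regularDistribution (g : ℝ → ℝ) : 𝓓'(halfLine, ℝ) :=
  ContinuousLinearMap.toUniformConvergenceCLM _ _ _
    (TestFunction.integralAgainstBilinCLM (ContinuousLinearMap.mul ℝ ℝ) volume g)

/-- The generalized Radon transform `R_α[μ](p, ·) ∈ 𝓓'(0, ∞)`: the distributional derivative of
`p₀ ↦ ∫_{p ⊙_α x ≤ p₀} μ(dx)`. -/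
def radon (α : ℝ) {n : ℕ} (μ : SignedBorelMeasure n) (p : Fin n → ℝ) : 𝓓'(halfLine, ℝ) :=
  ∂_{(1 : ℝ)} (regularDistribution fun p₀ => μ.value (sublevel α p p₀))

/-- The form `dx₁ ∧ … ∧ dxₙ` on `ℝⁿ`, i.e. the determinant of the matrix of `n` vectors. -/
def volForm (n : ℕ) : (Fin n → ℝ) [⋀^Fin n]→ₗ[ℝ] ℝ := (Pi.basisFun ℝ (Fin n)).det

/-- The exterior product of a covector and an alternating `m`-form,
`(φ ∧ ω)(v₀, …, vₘ) = ∑ᵢ (-1)ⁱ φ(vᵢ) ω(v₀, …, v̂ᵢ, …, vₘ)`. -/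
def wedge {m : ℕ} {V : Type*} [NormedAddCommGroup V] [NormedSpace ℝ V]
    (φ : V →L[ℝ] ℝ) (ω : V [⋀^Fin m]→L[ℝ] ℝ) : V [⋀^Fin (m + 1)]→L[ℝ] ℝ :=
  ContinuousAlternatingMap.alternatizeUncurryFin (φ.smulRight ω)

/-- The partial derivatives `∂φ/∂u₁(u), …, ∂φ/∂uₘ(u)` of a map defined on `ℝᵐ`. -/
def partials {m n : ℕ} (φ : (Fin m → ℝ) → (Fin n → ℝ)) (u : Fin m → ℝ) :
    Fin m → (Fin n → ℝ) :=
  fun j => fderiv ℝ φ u (Pi.single j 1)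

/-- `φ : U → S` is a positively oriented (global) `C¹` parametrization of the embedded hypersurface
`S ⊆ ℝ^{m+1}`. The hypersurface is oriented by a field of covectors `ν` which vanish exactly on
the tangent spaces: a basis `v₁, …, vₘ` of a tangent space is positive if `(w, v₁, …, vₘ)` is a
positive basis of `ℝ^{m+1}` for the transversal vectors `w` with `ν(w) > 0`. For `ν = dq`, on a
level set of `q`, this is the orientation as the boundary of the sublevel set of `q`
(outward vector first). -/
structure IsOrientedParametrization {m : ℕ} (S : Set (Fin (m + 1) → ℝ))
    (ν : (Fin (m + 1) → ℝ) → (Fin (m + 1) → ℝ) →L[ℝ] ℝ)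
    (U : Set (Fin m → ℝ)) (φ : (Fin m → ℝ) → (Fin (m + 1) → ℝ)) : Prop where
  isOpen : IsOpen U
  contDiffOn : ContDiffOn ℝ 1 φ U
  bijOn : BijOn φ U S
  immersion : ∀ u ∈ U, Function.Injective (fderiv ℝ φ u)
  oriented : ∀ u ∈ U, ∀ w, 0 < ν (φ u) w → 0 < volForm (m + 1) (Fin.cons w (partials φ u))

/-- The integral of the `m`-form `ω` over the hypersurface `S ⊆ ℝ^{m+1}` oriented by `ν` (which
has a global parametrization) converges absolutely and has the value `I`: in every positively
oriented parametrization, the pullback `φ^*ω = ω(∂φ/∂u₁, …, ∂φ/∂uₘ) du₁ ∧ … ∧ duₘ` is Lebesgue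
integrable with integral `I`. -/
def HasFormIntegral {m : ℕ} (S : Set (Fin (m + 1) → ℝ))
    (ν : (Fin (m + 1) → ℝ) → (Fin (m + 1) → ℝ) →L[ℝ] ℝ)
    (ω : (Fin (m + 1) → ℝ) → (Fin (m + 1) → ℝ) [⋀^Fin m]→L[ℝ] ℝ) (I : ℝ) : Prop :=
  (∃ U φ, IsOrientedParametrization S ν U φ) ∧
    ∀ U φ, IsOrientedParametrization S ν U φ →
      IntegrableOn (fun u => ω (φ u) (partials φ u)) U ∧
        ∫ u in U, ω (φ u) (partials φ u) = I

/-- The integral of `ω` over the oriented hypersurface `S` converges absolutely. -/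
def FormIntegrable {m : ℕ} (S : Set (Fin (m + 1) → ℝ))
    (ν : (Fin (m + 1) → ℝ) → (Fin (m + 1) → ℝ) →L[ℝ] ℝ)
    (ω : (Fin (m + 1) → ℝ) → (Fin (m + 1) → ℝ) [⋀^Fin m]→L[ℝ] ℝ) : Prop :=
  ∃ I, HasFormIntegral S ν ω I

open Classical in
/-- The value of the integral `∫_S ω`, if it converges absolutely (and `0` otherwise). -/
def formIntegral {m : ℕ} (S : Set (Fin (m + 1) → ℝ))
    (ν : (Fin (m + 1) → ℝ) → (Fin (m + 1) → ℝ) →L[ℝ] ℝ)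
    (ω : (Fin (m + 1) → ℝ) → (Fin (m + 1) → ℝ) [⋀^Fin m]→L[ℝ] ℝ) : ℝ :=
  if h : FormIntegrable S ν ω then h.choose else 0

/-- The value of `∫_S ω` is well defined: it is the integral in any parametrization. -/
theorem HasFormIntegral.formIntegral_eq {m : ℕ} {S : Set (Fin (m + 1) → ℝ)}
    {ν : (Fin (m + 1) → ℝ) → (Fin (m + 1) → ℝ) →L[ℝ] ℝ}
    {ω : (Fin (m + 1) → ℝ) → (Fin (m + 1) → ℝ) [⋀^Fin m]→L[ℝ] ℝ} {I : ℝ}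
    (h : HasFormIntegral S ν ω I) : formIntegral S ν ω = I := by
  have hI : FormIntegrable S ν ω := ⟨I, h⟩
  rw [formIntegral, dif_pos hI]
  obtain ⟨U, φ, hφ⟩ := h.1
  rw [← (hI.choose_spec.2 U φ hφ).2, (h.2 U φ hφ).2]

/-- The exterior derivative `d_x (p ⊙_α x)` of the CES function. -/
def dCes (α : ℝ) {n : ℕ} (p : Fin n → ℝ) : (Fin n → ℝ) → (Fin n → ℝ) →L[ℝ] ℝ :=
  fun x => fderiv ℝ (cesProd α p) x

/-- `Ω` satisfies `d_x(p ⊙_α x) ∧ Ω = dx₁ ∧ … ∧ dxₙ` (`n = m + 1`) on the interior of `ℝⁿ₊`, where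
the CES function is differentiable. -/
def IsLerayForm (α : ℝ) {m : ℕ} (p : Fin (m + 1) → ℝ)
    (Ω : (Fin (m + 1) → ℝ) → (Fin (m + 1) → ℝ) [⋀^Fin m]→L[ℝ] ℝ) : Prop :=
  ∀ x ∈ openOrthant (m + 1),
    (wedge (dCes α p x) (Ω x)).toAlternatingMap = volForm (m + 1)

/-- The integral `∫_{p ⊙_α x = s} a(x) Ω` over the level hypersurface, cooriented by
`d_x(p ⊙_α x)`. -/
def levelIntegral (α : ℝ) {m : ℕ} (p : Fin (m + 1) → ℝ) (a : (Fin (m + 1) → ℝ) → ℝ)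
    (Ω : (Fin (m + 1) → ℝ) → (Fin (m + 1) → ℝ) [⋀^Fin m]→L[ℝ] ℝ) (s : ℝ) : ℝ :=
  formIntegral (levelHypersurface α p s) (dCes α p) (fun x => a x • Ω x)

/-- The integral `∫_{p ⊙_α x = s} a(x) Ω` converges absolutely. -/
def LevelIntegrable (α : ℝ) {m : ℕ} (p : Fin (m + 1) → ℝ) (a : (Fin (m + 1) → ℝ) → ℝ)
    (Ω : (Fin (m + 1) → ℝ) → (Fin (m + 1) → ℝ) [⋀^Fin m]→L[ℝ] ℝ) (s : ℝ) : Prop :=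
  FormIntegrable (levelHypersurface α p s) (dCes α p) (fun x => a x • Ω x)

end CES

end

/-! Write q(x) = p ⊙_α x and choose k with p_k > 0. On the open orthant ∂q/∂x_k > 0, so x ↦ (q(x),
v), where v collects the coordinates other than x_k, is an injective change of variables with
Jacobian ∂q/∂x_k. Coordinate hyperplanes are null, hence μ(q ≤ T) is the integral of a / (∂q/∂x_k)
over the pairs (s, v) with 0 < s ≤ T and v in the projection of {q = s} (`integral_sublevel`).

On the other side, evaluating dq ∧ Ω on (w, tangent vectors) leaves only dq(w) Ω(tangent vectors).
The identity dq ∧ Ω = dx therefore determines Ω on each level set whatever its regularity: for a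
positively oriented parametrization φ, the Jacobian of v ∘ φ is ∂q/∂x_k times the pullback of Ω. So
F(s) is the integral of the same density over the projection of {q = s} (`integral_pullback`), and
Fubini yields μ(q ≤ T) = ∫₀^T F (`integral_sublevel_eq_levelIntegral`). Integration by parts against
test functions identifies the distributional derivative (`lineDeriv_regularDistribution`).

If all p_i > 0, homogeneity of q rescales F(s) to s^m times an integral over the fixed bounded
domain at level 1. There the integrand is bounded because x_k^{1-α} is bounded for α ≤ 1; dominated
convergence makes F continuous, and the fundamental theorem of calculus applies. -/

namespace CES

variable {m : ℕ} {α : ℝ}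

/-! ### The CES function on the orthant and its derivative -/

theorem isOpen_openOrthant (n : ℕ) : IsOpen (openOrthant n) := by
  simp only [openOrthant, ofPred_forall]
  exact isOpen_iInter_of_finite fun i => isOpen_lt continuous_const (continuous_apply i)

theorem openOrthant_subset_orthant (n : ℕ) : openOrthant n ⊆ orthant n :=
  fun _ hx i => (hx i).le

theorem isClosed_orthant (n : ℕ) : IsClosed (orthant n) := by
  simp only [orthant, ofPred_forall]
  exact isClosed_iInter fun i => isClosed_le continuous_const (continuous_apply i)

theorem orthant_ae_eq_openOrthant (n : ℕ) :
    openOrthant n =ᵐ[volume] orthant n := by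
  refine (openOrthant_subset_orthant n).eventuallyLE.antisymm ?_
  have h : ∀ᵐ x : Fin n → ℝ, ∀ i, x i ≠ 0 := by
    rw [ae_all_iff]
    intro i
    rw [ae_iff]
    simpa [volume_pi] using Measure.pi_hyperplane (fun _ : Fin n => (volume : Measure ℝ)) i 0
  filter_upwards [h] with x hx hx'
  exact fun i => lt_of_le_of_ne (hx' i) (hx i).symm

/-- The CES function is positive at the interior points of the orthant. -/
theorem sum_rpow_pos {n : ℕ} {p x : Fin n → ℝ} (hp : ∀ i, 0 ≤ p i) {k : Fin n} (hk : 0 < p k)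
    (hx : x ∈ openOrthant n) : 0 < ∑ i, (p i * x i) ^ α :=
  Finset.sum_pos' (fun i _ => Real.rpow_nonneg (mul_nonneg (hp i) (hx i).le) α)
    ⟨k, Finset.mem_univ k, Real.rpow_pos_of_pos (mul_pos hk (hx k)) α⟩

theorem cesProd_pos {n : ℕ} (hα : 0 < α) {p x : Fin n → ℝ} (hp : ∀ i, 0 ≤ p i) {k : Fin n}
    (hk : 0 < p k) (hx : x ∈ openOrthant n) : 0 < cesProd α p x := by
  rw [cesProd_eq hα p x hp fun i => (hx i).le]
  exact Real.rpow_pos_of_pos (sum_rpow_pos hp hk hx) _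

theorem cesProd_nonneg {n : ℕ} (hα : 0 < α) {p x : Fin n → ℝ} (hp : ∀ i, 0 ≤ p i)
    (hx : x ∈ orthant n) : 0 ≤ cesProd α p x := by
  rw [cesProd_eq hα p x hp hx]
  exact Real.rpow_nonneg
    (Finset.sum_nonneg fun i _ => Real.rpow_nonneg (mul_nonneg (hp i) (hx i)) α) _

theorem cesProd_rpow {n : ℕ} (hα : 0 < α) {p x : Fin n → ℝ} (hp : ∀ i, 0 ≤ p i)
    (hx : x ∈ orthant n) : cesProd α p x ^ α = ∑ i, (p i * x i) ^ α := by
  rw [cesProd_eq hα p x hp hx, ← Real.rpow_mul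
    (Finset.sum_nonneg fun i _ => Real.rpow_nonneg (mul_nonneg (hp i) (hx i)) α),
    one_div_mul_cancel hα.ne', Real.rpow_one]

theorem continuousOn_cesProd {n : ℕ} (hα : 0 < α) {p : Fin n → ℝ} (hp : ∀ i, 0 ≤ p i) :
    ContinuousOn (cesProd α p) (orthant n) := by
  have h : Continuous fun x : Fin n → ℝ => (∑ i, (p i * x i) ^ α) ^ (1 / α) := by
    refine Continuous.rpow_const (continuous_finsetSum _ fun i _ => ?_)
      fun _ => Or.inr (one_div_pos.mpr hα).le
    exact (continuous_const.mul (continuous_apply i)).rpow_const fun _ => Or.inr hα.le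
  exact h.continuousOn.congr fun x hx => cesProd_eq hα p x hp hx

theorem measurableSet_sublevel {n : ℕ} (hα : 0 < α) {p : Fin n → ℝ} (hp : ∀ i, 0 ≤ p i) (s : ℝ) :
    MeasurableSet (sublevel α p s) :=
  ((continuousOn_cesProd hα hp).preimage_isClosed_of_isClosed (isClosed_orthant n)
    isClosed_Iic).measurableSet

/-- Formula for the CES function exhibiting its smoothness on the open orthant. -/
theorem cesProd_eq_of_mem_openOrthant {n : ℕ} (hα : 0 < α) {p x : Fin n → ℝ} (hp : ∀ i, 0 ≤ p i)
    (hx : x ∈ openOrthant n) : cesProd α p x = (∑ i, p i ^ α * x i ^ α) ^ (1 / α) := by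
  rw [cesProd_eq hα p x hp fun i => (hx i).le]
  simp_rw [Real.mul_rpow (hp _) (hx _).le]

theorem contDiffOn_cesProd {n : ℕ} (hα : 0 < α) {p : Fin n → ℝ} (hp : ∀ i, 0 ≤ p i) {k : Fin n}
    (hk : 0 < p k) : ContDiffOn ℝ 1 (cesProd α p) (openOrthant n) := by
  have h : ContDiffOn ℝ 1 (fun x : Fin n → ℝ => (∑ i, p i ^ α * x i ^ α) ^ (1 / α))
      (openOrthant n) := by
    refine ContDiffOn.rpow_const_of_ne (ContDiffOn.sum fun i _ => ?_) fun x hx => ?_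
    · exact contDiffOn_const.mul
        (ContDiffOn.rpow_const_of_ne (contDiff_apply ℝ ℝ i).contDiffOn fun x hx => (hx i).ne')
    · have := sum_rpow_pos (α := α) hp hk hx
      simp_rw [Real.mul_rpow (hp _) (hx _).le] at this
      exact this.ne'
  exact h.congr fun x hx => cesProd_eq_of_mem_openOrthant hα hp hx

theorem hasFDerivAt_cesProd {n : ℕ} (hα : 0 < α) {p : Fin n → ℝ} (hp : ∀ i, 0 ≤ p i) {k : Fin n}
    (hk : 0 < p k) {x : Fin n → ℝ} (hx : x ∈ openOrthant n) :
    HasFDerivAt (cesProd α p) (dCes α p x) x :=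
  (((contDiffOn_cesProd hα hp hk).contDiffAt
    ((isOpen_openOrthant n).mem_nhds hx)).differentiableAt one_ne_zero).hasFDerivAt

/-- Differentiability is already known, so it suffices to differentiate the closed formula along the
line x + t e_k, which stays in the open orthant for small t. -/
theorem dCes_single {n : ℕ} (hα : 0 < α) {p : Fin n → ℝ} (hp : ∀ i, 0 ≤ p i) {k : Fin n}
    (hk : 0 < p k) {x : Fin n → ℝ} (hx : x ∈ openOrthant n) :
    dCes α p x (Pi.single k 1) = p k ^ α * x k ^ (α - 1) * cesProd α p x ^ (1 - α) := by
  have hS := sum_rpow_pos (α := α) hp hk hx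
  simp_rw [Real.mul_rpow (hp _) (hx _).le] at hS
  have hline : HasDerivAt (fun t : ℝ => x + t • (Pi.single k 1 : Fin n → ℝ)) (Pi.single k 1) 0 := by
    simpa using ((hasDerivAt_id (0 : ℝ)).smul_const (Pi.single k 1 : Fin n → ℝ)).const_add x
  have h0 : x + (0 : ℝ) • (Pi.single k 1 : Fin n → ℝ) = x := by simp
  have h1 : HasDerivAt (fun t : ℝ => cesProd α p (x + t • (Pi.single k 1 : Fin n → ℝ)))
      (dCes α p x (Pi.single k 1)) 0 := by
    refine HasFDerivAt.comp_hasDerivAt (l := cesProd α p) (0 : ℝ) ?_ hline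
    rw [h0]
    exact hasFDerivAt_cesProd hα hp hk hx
  have hsum : HasDerivAt
      (fun t : ℝ => ∑ i, p i ^ α * (x + t • (Pi.single k 1 : Fin n → ℝ)) i ^ α)
      (∑ i, p i ^ α * ((Pi.single k 1 : Fin n → ℝ) i * α * x i ^ (α - 1))) 0 := by
    refine HasDerivAt.fun_sum fun i _ => HasDerivAt.const_mul _ ?_
    have := (hasDerivAt_pi.mp hline i).rpow_const (p := α) (Or.inl (by simpa using (hx i).ne'))
    simpa using this
  have h2 := hsum.rpow_const (p := 1 / α) (Or.inl (by simpa using hS.ne'))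
  have hev : (fun t : ℝ => cesProd α p (x + t • (Pi.single k 1 : Fin n → ℝ))) =ᶠ[nhds 0]
      fun t => (∑ i, p i ^ α * (x + t • (Pi.single k 1 : Fin n → ℝ)) i ^ α) ^ (1 / α) := by
    have : ∀ᶠ t : ℝ in nhds 0, x + t • (Pi.single k 1 : Fin n → ℝ) ∈ openOrthant n := by
      refine hline.continuousAt.eventually_mem ?_
      rw [h0]
      exact (isOpen_openOrthant n).mem_nhds hx
    filter_upwards [this] with t ht using cesProd_eq_of_mem_openOrthant hα hp ht
  rw [h1.unique (h2.congr_of_eventuallyEq hev), cesProd_eq_of_mem_openOrthant hα hp hx,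
    ← Real.rpow_mul hS.le, Finset.sum_eq_single k (by intro i _ hi; simp [hi]) (by simp)]
  have : 1 / α * (1 - α) = 1 / α - 1 := by field_simp
  rw [this]
  simp only [Pi.single_eq_same, zero_smul, add_zero]
  field_simp

theorem dCes_single_pos {n : ℕ} (hα : 0 < α) {p : Fin n → ℝ} (hp : ∀ i, 0 ≤ p i) {k : Fin n}
    (hk : 0 < p k) {x : Fin n → ℝ} (hx : x ∈ openOrthant n) :
    0 < dCes α p x (Pi.single k 1) := by
  rw [dCes_single hα hp hk hx]
  have := cesProd_pos hα hp hk hx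
  have := hx k
  positivity

/-- A Leray form evaluates on vectors tangent to the level hypersurface as a volume. -/
theorem IsLerayForm.dCes_mul_apply {p : Fin (m + 1) → ℝ}
    {Ω : (Fin (m + 1) → ℝ) → (Fin (m + 1) → ℝ) [⋀^Fin m]→L[ℝ] ℝ} (hΩ : IsLerayForm α p Ω)
    {x : Fin (m + 1) → ℝ} (hx : x ∈ openOrthant (m + 1)) {v : Fin m → Fin (m + 1) → ℝ}
    (hv : ∀ j, dCes α p x (v j) = 0) (w : Fin (m + 1) → ℝ) :
    dCes α p x w * Ω x v = volForm (m + 1) (Fin.cons w v : Fin (m + 1) → Fin (m + 1) → ℝ) := by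
  have h := DFunLike.congr_fun (hΩ x hx) (Fin.cons w v : Fin (m + 1) → Fin (m + 1) → ℝ)
  rw [← h]
  simp only [ContinuousAlternatingMap.coe_toAlternatingMap, wedge,
    ContinuousAlternatingMap.alternatizeUncurryFin_apply]
  -- In the alternating sum every term but the first feeds some v j to `dCes` and vanishes.
  rw [Fin.sum_univ_succ]
  simp [hv]

/-! ### Projections along a coordinate axis, with orientation -/

theorem volForm_apply {n : ℕ} (v : Fin n → Fin n → ℝ) : volForm n v = (Matrix.of v).det := by
  rw [volForm, Module.Basis.det_apply, ← Matrix.det_transpose]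
  rfl

/-- A linear projection along the `k`-th coordinate axis onto `ℝᵐ`, with a section with values in
the hyperplane `xₖ = 0`, compatible with the orientations. -/
structure AxisProjection (k : Fin (m + 1)) where
  proj : (Fin (m + 1) → ℝ) →L[ℝ] (Fin m → ℝ)
  lift : (Fin m → ℝ) →L[ℝ] (Fin (m + 1) → ℝ)
  proj_single : proj (Pi.single k 1) = 0
  proj_lift : ∀ v, proj (lift v) = v
  smul_single_add_lift : ∀ x, x k • Pi.single k 1 + lift (proj x) = x
  volForm_cons_single : ∀ v : Fin m → Fin (m + 1) → ℝ,
    volForm (m + 1) (Fin.cons (Pi.single k 1) v : Fin (m + 1) → Fin (m + 1) → ℝ) =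
      (Matrix.of fun j => proj (v j)).det

/-- Moving index k to the front by a transposition reverses orientation; one sign change, away from
position 0, restores it. -/
theorem exists_perm_sign (k : Fin (m + 1)) :
    ∃ (σ : Equiv.Perm (Fin (m + 1))) (d : Fin (m + 1) → ℝ), σ 0 = k ∧ d 0 = 1 ∧
      (∀ i, d i * d i = 1) ∧ (∏ i, d i) * ((Equiv.Perm.sign σ : ℤ) : ℝ) = 1 := by
  by_cases hk : k = 0
  · exact ⟨1, 1, by simp [hk], rfl, by simp, by simp⟩
  · refine ⟨Equiv.swap 0 k, Function.update 1 k (-1), by simp, ?_, fun i => ?_, ?_⟩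
    · simp [Function.update_of_ne (Ne.symm hk)]
    · by_cases hi : i = k
      · subst hi; simp
      · simp [Function.update_of_ne hi]
    · rw [Equiv.Perm.sign_swap (Ne.symm hk), Finset.prod_update_of_mem (Finset.mem_univ k)]
      simp

theorem exists_axisProjection (k : Fin (m + 1)) : Nonempty (AxisProjection k) := by
  obtain ⟨σ, d, hσ, hd0, hd, hdet⟩ := exists_perm_sign k
  have hσk : ∀ j : Fin m, σ j.succ ≠ k := fun j h =>
    Fin.succ_ne_zero j (σ.injective (h.trans hσ.symm))
  have hσ' : σ.symm k = 0 := by rw [← hσ, Equiv.symm_apply_apply]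
  refine ⟨{
    proj := ContinuousLinearMap.pi fun j => d j.succ • ContinuousLinearMap.proj (σ j.succ)
    lift := ContinuousLinearMap.pi fun i => Fin.cases (motive := fun _ => (Fin m → ℝ) →L[ℝ] ℝ) 0
      (fun j => d j.succ • ContinuousLinearMap.proj j) (σ.symm i)
    proj_single := ?_
    proj_lift := ?_
    smul_single_add_lift := ?_
    volForm_cons_single := ?_ }⟩
  · ext j
    simp [hσk j]
  · intro v
    ext j
    simp [← mul_assoc, hd]
  · intro x
    ext i
    obtain ⟨j, rfl⟩ := σ.surjective i
    refine Fin.cases ?_ (fun j => ?_) j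
    · simp [hσ, hσ']
    · simp [hσk j, ← mul_assoc, hd]
  · intro v
    set M : Matrix (Fin (m + 1)) (Fin (m + 1)) ℝ := Matrix.of (Fin.cons (Pi.single k 1) v)
    -- Permuting the columns by σ and scaling them by d preserves the determinant and turns the
    -- first row into e₀. Expansion along that row leaves the minor with rows proj (v j).
    have h1 := Matrix.det_mul_row d (M.submatrix id σ)
    rw [Matrix.det_permute', ← mul_assoc, hdet, one_mul] at h1
    rw [volForm_apply, ← h1, Matrix.det_succ_row_zero, Fin.sum_univ_succ]
    have h0 : ∀ j : Fin m, (Pi.single k 1 : Fin (m + 1) → ℝ) (σ j.succ) = 0 := fun j => by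
      simp [hσk j]
    simp [M, hσ, hd0, h0]
    rfl

/-! ### The level hypersurface as a graph -/

namespace AxisProjection

variable {k : Fin (m + 1)} (A : AxisProjection k)

theorem lift_apply_self (v : Fin m → ℝ) : A.lift v k = 0 := by
  have h := A.smul_single_add_lift (A.lift v)
  rw [A.proj_lift, add_eq_right] at h
  simpa using congrFun h k

/-- The part of the CES function, raised to the power `α`, independent of `xₖ`. -/
noncomputable def base (α : ℝ) (p : Fin (m + 1) → ℝ) (v : Fin m → ℝ) : ℝ :=
  ∑ i ∈ Finset.univ.erase k, (p i * A.lift v i) ^ α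

/-- The projection of the level hypersurface. -/
def domain (α : ℝ) (p : Fin (m + 1) → ℝ) (s : ℝ) : Set (Fin m → ℝ) :=
  {v | (∀ i, i ≠ k → 0 < A.lift v i) ∧ A.base α p v < s ^ α}

/-- The parametrization of the level hypersurface as a graph over its projection. -/
noncomputable def graph (α : ℝ) (p : Fin (m + 1) → ℝ) (s : ℝ) (v : Fin m → ℝ) : Fin (m + 1) → ℝ :=
  ((s ^ α - A.base α p v) ^ (1 / α) / p k) • Pi.single k 1 + A.lift v

theorem graph_apply_self (p : Fin (m + 1) → ℝ) (s : ℝ) (v : Fin m → ℝ) :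
    A.graph α p s v k = (s ^ α - A.base α p v) ^ (1 / α) / p k := by
  simp [graph, lift_apply_self]

theorem graph_apply_of_ne (p : Fin (m + 1) → ℝ) (s : ℝ) (v : Fin m → ℝ) {i : Fin (m + 1)}
    (hi : i ≠ k) : A.graph α p s v i = A.lift v i := by
  simp [graph, hi]

theorem proj_graph (p : Fin (m + 1) → ℝ) (s : ℝ) (v : Fin m → ℝ) :
    A.proj (A.graph α p s v) = v := by
  simp [graph, A.proj_single, A.proj_lift]

theorem lift_proj_of_ne (x : Fin (m + 1) → ℝ) {i : Fin (m + 1)} (hi : i ≠ k) :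
    A.lift (A.proj x) i = x i := by
  simpa [hi] using congrFun (A.smul_single_add_lift x) i

theorem base_proj (p x : Fin (m + 1) → ℝ) :
    A.base α p (A.proj x) = ∑ i ∈ Finset.univ.erase k, (p i * x i) ^ α :=
  Finset.sum_congr rfl fun i hi => by rw [A.lift_proj_of_ne x (Finset.ne_of_mem_erase hi)]

theorem continuous_base (hα : 0 < α) (p : Fin (m + 1) → ℝ) : Continuous (A.base α p) :=
  continuous_finsetSum _ fun i _ => (continuous_const.mul
    ((continuous_apply i).comp A.lift.continuous)).rpow_const fun _ => Or.inr hα.le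

variable {p : Fin (m + 1) → ℝ}

theorem graph_mem_levelHypersurface (hα : 0 < α) (hp : ∀ i, 0 ≤ p i) (hk : 0 < p k) {s : ℝ}
    (hs : 0 < s) {v : Fin m → ℝ} (hv : v ∈ A.domain α p s) :
    A.graph α p s v ∈ levelHypersurface α p s := by
  have hpos : 0 < s ^ α - A.base α p v := sub_pos.mpr hv.2
  have hmem : A.graph α p s v ∈ openOrthant (m + 1) := by
    intro i
    by_cases hi : i = k
    · subst hi
      rw [graph_apply_self]
      exact div_pos (Real.rpow_pos_of_pos hpos _) hk
    · rw [A.graph_apply_of_ne p s v hi]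
      exact hv.1 i hi
  refine ⟨hmem, ?_⟩
  rw [cesProd_eq hα p _ hp fun i => (hmem i).le,
    ← Finset.add_sum_erase _ _ (Finset.mem_univ k), ← A.base_proj, proj_graph, graph_apply_self,
    mul_div_cancel₀ _ hk.ne', ← Real.rpow_mul hpos.le, one_div_mul_cancel hα.ne', Real.rpow_one,
    sub_add_cancel, ← Real.rpow_mul hs.le, mul_one_div_cancel hα.ne', Real.rpow_one]

theorem cesProd_rpow_sub_base (hα : 0 < α) (hp : ∀ i, 0 ≤ p i) {x : Fin (m + 1) → ℝ}
    (hx : x ∈ orthant (m + 1)) :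
    cesProd α p x ^ α - A.base α p (A.proj x) = (p k * x k) ^ α := by
  rw [cesProd_rpow hα hp hx, A.base_proj, ← Finset.add_sum_erase _ _ (Finset.mem_univ k),
    add_sub_cancel_right]

theorem proj_mem_domain (hα : 0 < α) (hp : ∀ i, 0 ≤ p i) (hk : 0 < p k)
    {x : Fin (m + 1) → ℝ} (hx : x ∈ openOrthant (m + 1)) :
    A.proj x ∈ A.domain α p (cesProd α p x) := by
  refine ⟨fun i hi => ?_, ?_⟩
  · rw [A.lift_proj_of_ne x hi]
    exact hx i
  · rw [← sub_pos, A.cesProd_rpow_sub_base hα hp fun i => (hx i).le]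
    exact Real.rpow_pos_of_pos (mul_pos hk (hx k)) α

theorem graph_proj (hα : 0 < α) (hp : ∀ i, 0 ≤ p i) (hk : 0 < p k)
    {x : Fin (m + 1) → ℝ} (hx : x ∈ orthant (m + 1)) :
    A.graph α p (cesProd α p x) (A.proj x) = x := by
  have hpx : 0 ≤ p k * x k := mul_nonneg hk.le (hx k)
  rw [graph, A.cesProd_rpow_sub_base hα hp hx, ← Real.rpow_mul hpx, mul_one_div_cancel hα.ne',
    Real.rpow_one, mul_div_cancel_left₀ _ hk.ne', A.smul_single_add_lift]

theorem bijOn_graph (hα : 0 < α) (hp : ∀ i, 0 ≤ p i) (hk : 0 < p k) {s : ℝ} (hs : 0 < s) :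
    BijOn (A.graph α p s) (A.domain α p s) (levelHypersurface α p s) := by
  refine ⟨fun v hv => A.graph_mem_levelHypersurface hα hp hk hs hv,
    (Function.LeftInverse.injective (A.proj_graph p s)).injOn, ?_⟩
  rintro x ⟨hx, rfl⟩
  exact ⟨A.proj x, A.proj_mem_domain hα hp hk hx, A.graph_proj hα hp hk fun i => (hx i).le⟩

theorem isOpen_domain (hα : 0 < α) (p : Fin (m + 1) → ℝ) (s : ℝ) :
    IsOpen (A.domain α p s) := by
  have h : A.domain α p s =
      (⋂ i, ⋂ _ : i ≠ k, {v | 0 < A.lift v i}) ∩ {v | A.base α p v < s ^ α} := by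
    ext v
    simp [domain]
  rw [h]
  refine IsOpen.inter ?_ (isOpen_lt (A.continuous_base hα p) continuous_const)
  exact isOpen_iInter_of_finite fun i => isOpen_iInter_of_finite fun _ =>
    isOpen_lt continuous_const ((continuous_apply i).comp A.lift.continuous)

theorem contDiffOn_graph (hp : ∀ i, 0 ≤ p i) (s : ℝ) :
    ContDiffOn ℝ 1 (A.graph α p s) (A.domain α p s) := by
  have hlift : ∀ i, ContDiffOn ℝ 1 (fun v => A.lift v i) (A.domain α p s) := fun i =>
    ((contDiff_apply ℝ ℝ i).comp A.lift.contDiff).contDiffOn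
  have hbase : ContDiffOn ℝ 1 (A.base α p) (A.domain α p s) := by
    -- Splitting off p i ^ α keeps the base of the power nonzero even where p i = 0.
    have h : ContDiffOn ℝ 1 (fun v => ∑ i ∈ Finset.univ.erase k, p i ^ α * A.lift v i ^ α)
        (A.domain α p s) :=
      ContDiffOn.sum fun i hi => contDiffOn_const.mul
        (ContDiffOn.rpow_const_of_ne (hlift i) fun v hv =>
          (hv.1 i (Finset.ne_of_mem_erase hi)).ne')
    refine h.congr fun v hv => Finset.sum_congr rfl fun i hi => ?_
    rw [Real.mul_rpow (hp i) (hv.1 i (Finset.ne_of_mem_erase hi)).le]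
  have hroot : ContDiffOn ℝ 1 (fun v => (s ^ α - A.base α p v) ^ (1 / α)) (A.domain α p s) :=
    ContDiffOn.rpow_const_of_ne (contDiffOn_const.sub hbase) fun v hv => (sub_pos.mpr hv.2).ne'
  have hsmul : ContDiffOn ℝ 1 (fun v => ((s ^ α - A.base α p v) ^ (1 / α) / p k) •
      (Pi.single k 1 : Fin (m + 1) → ℝ)) (A.domain α p s) :=
    (hroot.div_const _).smul contDiffOn_const
  exact hsmul.add A.lift.contDiff.contDiffOn

end AxisProjection

/-- Vectors tangent to a parametrization of a level hypersurface are annihilated by the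
derivative. -/
theorem dCes_partials_eq_zero (hα : 0 < α) {p : Fin (m + 1) → ℝ} (hp : ∀ i, 0 ≤ p i)
    {k : Fin (m + 1)} (hk : 0 < p k) {s : ℝ} {U : Set (Fin m → ℝ)}
    {φ : (Fin m → ℝ) → (Fin (m + 1) → ℝ)} (hU : IsOpen U) (hφ : ContDiffOn ℝ 1 φ U)
    (hmaps : MapsTo φ U (levelHypersurface α p s)) {u : Fin m → ℝ} (hu : u ∈ U) (j : Fin m) :
    dCes α p (φ u) (partials φ u j) = 0 := by
  have hd : DifferentiableAt ℝ φ u :=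
    (hφ.contDiffAt (hU.mem_nhds hu)).differentiableAt one_ne_zero
  have h1 := (hasFDerivAt_cesProd hα hp hk (hmaps hu).1).comp u hd.hasFDerivAt
  have h2 : HasFDerivAt (cesProd α p ∘ φ) (0 : (Fin m → ℝ) →L[ℝ] ℝ) u := by
    refine (hasFDerivAt_const s u).congr_of_eventuallyEq ?_
    filter_upwards [hU.mem_nhds hu] with w hw using (hmaps hw).2
  exact DFunLike.congr_fun (h1.unique h2) (Pi.single j 1)

/-! ### Pullback of the Leray form to the projection -/

namespace AxisProjection

variable {k : Fin (m + 1)} (A : AxisProjection k) {p : Fin (m + 1) → ℝ}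
  {Ω : (Fin (m + 1) → ℝ) → (Fin (m + 1) → ℝ) [⋀^Fin m]→L[ℝ] ℝ}

theorem det_proj_comp (T : (Fin m → ℝ) →L[ℝ] (Fin (m + 1) → ℝ)) :
    (A.proj.comp T).det = (Matrix.of fun j => A.proj (T (Pi.single j 1))).det := by
  rw [ContinuousLinearMap.det, ← LinearMap.det_toMatrix', ← Matrix.det_transpose]
  congr 1

/-- The pullback of a Leray form in terms of the projected parametrization. -/
theorem dCes_single_mul_leray (hα : 0 < α) (hp : ∀ i, 0 ≤ p i) (hk : 0 < p k)
    (hΩ : IsLerayForm α p Ω) {s : ℝ} {U : Set (Fin m → ℝ)}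
    {φ : (Fin m → ℝ) → (Fin (m + 1) → ℝ)} (hU : IsOpen U) (hφ : ContDiffOn ℝ 1 φ U)
    (hmaps : MapsTo φ U (levelHypersurface α p s)) {u : Fin m → ℝ} (hu : u ∈ U) :
    dCes α p (φ u) (Pi.single k 1) * Ω (φ u) (partials φ u) =
      (A.proj.comp (fderiv ℝ φ u)).det := by
  rw [hΩ.dCes_mul_apply (hmaps hu).1 (dCes_partials_eq_zero hα hp hk hU hφ hmaps hu),
    A.volForm_cons_single, A.det_proj_comp]
  rfl

theorem hasFDerivAt_proj_comp {U : Set (Fin m → ℝ)} {φ : (Fin m → ℝ) → (Fin (m + 1) → ℝ)}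
    (hU : IsOpen U) (hφ : ContDiffOn ℝ 1 φ U) {u : Fin m → ℝ} (hu : u ∈ U) :
    HasFDerivAt (A.proj ∘ φ) (A.proj.comp (fderiv ℝ φ u)) u :=
  A.proj.hasFDerivAt.comp u
    ((hφ.contDiffAt (hU.mem_nhds hu)).differentiableAt one_ne_zero).hasFDerivAt

theorem proj_comp_fderiv_graph (hα : 0 < α) (hp : ∀ i, 0 ≤ p i) {s : ℝ} {v : Fin m → ℝ}
    (hv : v ∈ A.domain α p s) :
    A.proj.comp (fderiv ℝ (A.graph α p s) v) = ContinuousLinearMap.id ℝ _ := by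
  have h := A.hasFDerivAt_proj_comp (A.isOpen_domain hα p s) (A.contDiffOn_graph hp s) hv
  have h' : A.proj ∘ A.graph α p s = id := funext fun v => A.proj_graph p s v
  rw [h'] at h
  exact h.unique (hasFDerivAt_id v)

/-- The projection inverts the graph map, so ∂q/∂x_k times the pulled-back Leray form is 1. That
form is thus positive, and multiplying it by ν(w) > 0 gives the oriented volume. -/
theorem isOrientedParametrization_graph (hα : 0 < α) (hp : ∀ i, 0 ≤ p i) (hk : 0 < p k)
    (hΩ : IsLerayForm α p Ω) {s : ℝ} (hs : 0 < s) :
    IsOrientedParametrization (levelHypersurface α p s) (dCes α p) (A.domain α p s)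
      (A.graph α p s) where
  isOpen := A.isOpen_domain hα p s
  contDiffOn := A.contDiffOn_graph hp s
  bijOn := A.bijOn_graph hα hp hk hs
  immersion u hu := by
    refine Function.Injective.of_comp (f := A.proj) ?_
    rw [← ContinuousLinearMap.coe_comp, A.proj_comp_fderiv_graph hα hp hu]
    exact Function.injective_id
  oriented u hu w hw := by
    have hmaps := (A.bijOn_graph hα hp hk hs).mapsTo
    have h := A.dCes_single_mul_leray hα hp hk hΩ (A.isOpen_domain hα p s)
      (A.contDiffOn_graph hp s) hmaps hu
    rw [A.proj_comp_fderiv_graph hα hp hu, ContinuousLinearMap.det, ContinuousLinearMap.coe_id,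
      LinearMap.det_id] at h
    rw [← hΩ.dCes_mul_apply (hmaps hu).1
      (dCes_partials_eq_zero hα hp hk (A.isOpen_domain hα p s) (A.contDiffOn_graph hp s) hmaps hu)]
    refine mul_pos hw (pos_of_mul_pos_right ?_ (dCes_single_pos hα hp hk (hmaps hu).1).le)
    rw [h]
    exact one_pos

/-- The density, with respect to Lebesgue measure on the projection, of the form `a Ω` on the level
hypersurface. -/
noncomputable def density (α : ℝ) (p : Fin (m + 1) → ℝ) (a : (Fin (m + 1) → ℝ) → ℝ) (s : ℝ) (v : Fin m → ℝ) : ℝ :=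
  (dCes α p (A.graph α p s v) (Pi.single k 1))⁻¹ * a (A.graph α p s v)

theorem density_proj (hα : 0 < α) (hp : ∀ i, 0 ≤ p i) (hk : 0 < p k)
    (a : (Fin (m + 1) → ℝ) → ℝ) {x : Fin (m + 1) → ℝ} (hx : x ∈ orthant (m + 1)) :
    A.density α p a (cesProd α p x) (A.proj x) = (dCes α p x (Pi.single k 1))⁻¹ * a x := by
  rw [density, A.graph_proj hα hp hk hx]

/-- Change of variables along proj ∘ φ, a bijection onto the domain of the graph. Its Jacobian
contains the factor ∂q/∂x_k, which cancels the inverse in `density`. The right-hand sides do not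
involve φ, so the form integral is well defined. -/
theorem integral_pullback (hα : 0 < α) (hp : ∀ i, 0 ≤ p i) (hk : 0 < p k)
    (hΩ : IsLerayForm α p Ω) (a : (Fin (m + 1) → ℝ) → ℝ) {s : ℝ} (hs : 0 < s)
    {U : Set (Fin m → ℝ)} {φ : (Fin m → ℝ) → (Fin (m + 1) → ℝ)}
    (hφ : IsOrientedParametrization (levelHypersurface α p s) (dCes α p) U φ) :
    (IntegrableOn (fun u => (a (φ u) • Ω (φ u)) (partials φ u)) U ↔
      IntegrableOn (A.density α p a s) (A.domain α p s)) ∧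
    ∫ u in U, (a (φ u) • Ω (φ u)) (partials φ u) =
      ∫ v in A.domain α p s, A.density α p a s v := by
  have hU := hφ.isOpen.measurableSet
  have hmaps := hφ.bijOn.mapsTo
  have himage : (A.proj ∘ φ) '' U = A.domain α p s := by
    rw [image_comp, hφ.bijOn.image_eq]
    ext v
    constructor
    · rintro ⟨x, ⟨hx, rfl⟩, rfl⟩
      exact A.proj_mem_domain hα hp hk hx
    · intro hv
      exact ⟨_, A.graph_mem_levelHypersurface hα hp hk hs hv, A.proj_graph p s v⟩
  have hinj : InjOn (A.proj ∘ φ) U := by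
    refine InjOn.comp (t := levelHypersurface α p s) ?_ hφ.bijOn.injOn hmaps
    rintro x ⟨hx, hxs⟩ y ⟨hy, hys⟩ hxy
    rw [← A.graph_proj hα hp hk fun i => (hx i).le, hxs, ← hys, hxy,
      A.graph_proj hα hp hk fun i => (hy i).le]
  have hderiv : ∀ u ∈ U, HasFDerivWithinAt (A.proj ∘ φ) (A.proj.comp (fderiv ℝ φ u)) U u :=
    fun u hu => (A.hasFDerivAt_proj_comp hφ.isOpen hφ.contDiffOn hu).hasFDerivWithinAt
  have hpull : ∀ u ∈ U, |(A.proj.comp (fderiv ℝ φ u)).det| • A.density α p a s ((A.proj ∘ φ) u) =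
      (a (φ u) • Ω (φ u)) (partials φ u) := by
    intro u hu
    have hx := (hmaps hu).1
    have hpos := dCes_single_pos hα hp hk hx
    have h := A.dCes_single_mul_leray hα hp hk hΩ hφ.isOpen hφ.contDiffOn hmaps hu
    -- Testing the orientation on w = e_k removes the absolute value of the Jacobian.
    have hor := hφ.oriented u hu _ hpos
    rw [← hΩ.dCes_mul_apply hx
      (dCes_partials_eq_zero hα hp hk hφ.isOpen hφ.contDiffOn hmaps hu)] at hor
    rw [← h, abs_of_pos hor, Function.comp_apply, ← (hmaps hu).2,
      A.density_proj hα hp hk a fun i => (hx i).le]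
    simp only [smul_eq_mul, ContinuousAlternatingMap.smul_apply]
    field_simp
  rw [← himage]
  constructor
  · rw [integrableOn_image_iff_integrableOn_abs_det_fderiv_smul volume hU hderiv hinj]
    exact (integrableOn_congr_fun hpull hU).symm
  · rw [integral_image_eq_integral_abs_det_fderiv_smul volume hU hderiv hinj]
    exact (setIntegral_congr_fun hU hpull).symm

theorem levelIntegrable_iff (hα : 0 < α) (hp : ∀ i, 0 ≤ p i) (hk : 0 < p k)
    (hΩ : IsLerayForm α p Ω) (a : (Fin (m + 1) → ℝ) → ℝ) {s : ℝ} (hs : 0 < s) :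
    LevelIntegrable α p a Ω s ↔ IntegrableOn (A.density α p a s) (A.domain α p s) := by
  have hg := A.isOrientedParametrization_graph hα hp hk hΩ hs
  constructor
  · rintro ⟨I, -, h⟩
    exact (A.integral_pullback hα hp hk hΩ a hs hg).1.mp (h _ _ hg).1
  · exact fun h => ⟨_, ⟨_, _, hg⟩, fun U φ hφ =>
      ⟨(A.integral_pullback hα hp hk hΩ a hs hφ).1.mpr h, (A.integral_pullback hα hp hk hΩ a hs hφ).2⟩⟩

theorem levelIntegral_eq (hα : 0 < α) (hp : ∀ i, 0 ≤ p i) (hk : 0 < p k)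
    (hΩ : IsLerayForm α p Ω) (a : (Fin (m + 1) → ℝ) → ℝ) {s : ℝ} (hs : 0 < s) :
    levelIntegral α p a Ω s = ∫ v in A.domain α p s, A.density α p a s v := by
  by_cases h : IntegrableOn (A.density α p a s) (A.domain α p s)
  · exact HasFormIntegral.formIntegral_eq
      ⟨⟨_, _, A.isOrientedParametrization_graph hα hp hk hΩ hs⟩, fun U φ hφ =>
        ⟨(A.integral_pullback hα hp hk hΩ a hs hφ).1.mpr h,
          (A.integral_pullback hα hp hk hΩ a hs hφ).2⟩⟩
  -- Without absolute convergence both sides take the default value 0.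
  · rw [integral_undef h]
    exact dif_neg (mt (A.levelIntegrable_iff hα hp hk hΩ a hs).mp h)

end AxisProjection

/-! ### Curvilinear coordinates on the sublevel set -/

namespace AxisProjection

variable {k : Fin (m + 1)} (A : AxisProjection k) {p : Fin (m + 1) → ℝ}
  {Ω : (Fin (m + 1) → ℝ) → (Fin (m + 1) → ℝ) [⋀^Fin m]→L[ℝ] ℝ}

/-- The linear map `w ↦ (ℓ(w), proj w)`. -/
noncomputable def consProj (ℓ : (Fin (m + 1) → ℝ) →L[ℝ] ℝ) :
    (Fin (m + 1) → ℝ) →L[ℝ] (Fin (m + 1) → ℝ) :=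
  ContinuousLinearMap.pi fun i => Fin.cases (motive := fun _ => (Fin (m + 1) → ℝ) →L[ℝ] ℝ) ℓ
    (fun j => (ContinuousLinearMap.proj j).comp A.proj) i

/-- The vectors e_k, lift e₁, …, lift e_m have determinant 1. Their images form a triangular matrix
with diagonal ℓ(e_k), 1, …, 1. -/
theorem det_consProj (ℓ : (Fin (m + 1) → ℝ) →L[ℝ] ℝ) :
    (A.consProj ℓ).det = ℓ (Pi.single k 1) := by
  set v : Fin (m + 1) → Fin (m + 1) → ℝ :=
    Fin.cons (Pi.single k 1) (fun j => A.lift (Pi.single j 1)) with hv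
  have hone : (Matrix.of fun j : Fin m => (Pi.single j 1 : Fin m → ℝ)) = 1 := by
    ext i j
    simp [Matrix.one_apply, Pi.single_apply, eq_comm]
  have h1 : volForm (m + 1) v = 1 := by
    rw [hv, A.volForm_cons_single]
    simp [A.proj_lift, hone]
  have h2 : volForm (m + 1) (A.consProj ℓ ∘ v) = (A.consProj ℓ).det * volForm (m + 1) v :=
    Module.Basis.det_comp _ _ _
  rw [h1, mul_one] at h2
  rw [← h2, volForm_apply, Matrix.det_succ_row_zero, Fin.sum_univ_succ, Finset.sum_eq_zero]
  · have : (Matrix.of (A.consProj ℓ ∘ v)).submatrix Fin.succ (Fin.succAbove 0) =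
        (1 : Matrix (Fin m) (Fin m) ℝ) := by
      ext i j
      simp [hv, consProj, A.proj_lift, Matrix.one_apply, Pi.single_apply, eq_comm]
    rw [this]
    simp [hv, consProj]
  · intro j _
    simp [hv, consProj, A.proj_single]

/-- The curvilinear coordinates `x ↦ (p ⊙_α x, proj x)`. -/
noncomputable def chart (α : ℝ) (p x : Fin (m + 1) → ℝ) : Fin (m + 1) → ℝ :=
  Fin.cons (cesProd α p x) (A.proj x)

theorem hasFDerivAt_chart (hα : 0 < α) (hp : ∀ i, 0 ≤ p i) (hk : 0 < p k)
    {x : Fin (m + 1) → ℝ} (hx : x ∈ openOrthant (m + 1)) :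
    HasFDerivAt (A.chart α p) (A.consProj (dCes α p x)) x := by
  rw [hasFDerivAt_pi']
  intro i
  refine Fin.cases ?_ (fun j => ?_) i
  · exact hasFDerivAt_cesProd hα hp hk hx
  · exact ((ContinuousLinearMap.proj (R := ℝ) (φ := fun _ : Fin m => ℝ) j).comp
      A.proj).hasFDerivAt

theorem injOn_chart (hα : 0 < α) (hp : ∀ i, 0 ≤ p i) (hk : 0 < p k) :
    InjOn (A.chart α p) (orthant (m + 1)) := by
  intro x hx y hy hxy
  obtain ⟨h1, h2⟩ := Fin.cons_injective2 hxy
  rw [← A.graph_proj hα hp hk hx, h1, h2, A.graph_proj hα hp hk hy]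

/-- The range of the curvilinear coordinates on the sublevel set `{p ⊙_α x ≤ T}`. -/
def chartRange (α : ℝ) (p : Fin (m + 1) → ℝ) (T : ℝ) : Set (ℝ × (Fin m → ℝ)) :=
  {y | y.1 ∈ Ioc 0 T ∧ y.2 ∈ A.domain α p y.1}

theorem measurableSet_chartRange (hα : 0 < α) (p : Fin (m + 1) → ℝ) (T : ℝ) :
    MeasurableSet (A.chartRange α p T) := by
  have h : A.chartRange α p T = Prod.fst ⁻¹' Ioc 0 T ∩
      ((⋂ i, ⋂ _ : i ≠ k, {y | 0 < A.lift y.2 i}) ∩ {y | A.base α p y.2 < y.1 ^ α}) := by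
    ext v
    simp [domain, chartRange]
  rw [h]
  refine (measurable_fst measurableSet_Ioc).inter (IsOpen.inter ?_ ?_).measurableSet
  · exact isOpen_iInter_of_finite fun i => isOpen_iInter_of_finite fun _ =>
      isOpen_lt continuous_const ((continuous_apply i).comp (A.lift.continuous.comp continuous_snd))
  · exact isOpen_lt ((A.continuous_base hα p).comp continuous_snd)
      (continuous_fst.rpow_const fun _ => Or.inr hα.le)

theorem image_chart (hα : 0 < α) (hp : ∀ i, 0 ≤ p i) (hk : 0 < p k) (T : ℝ) :
    A.chart α p '' (openOrthant (m + 1) ∩ sublevel α p T) =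
      MeasurableEquiv.piFinSuccAbove (fun _ => ℝ) 0 ⁻¹' A.chartRange α p T := by
  ext y
  constructor
  · rintro ⟨x, ⟨hx, -, hxT⟩, rfl⟩
    exact ⟨⟨cesProd_pos hα hp hk hx, hxT⟩, A.proj_mem_domain hα hp hk hx⟩
  · rintro ⟨⟨h0, hT⟩, hdom⟩
    obtain ⟨hmem, hq⟩ := A.graph_mem_levelHypersurface hα hp hk h0 hdom
    refine ⟨_, ⟨hmem, openOrthant_subset_orthant _ hmem, hq.trans_le hT⟩, ?_⟩
    rw [chart, hq, A.proj_graph]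
    exact Fin.cons_self_tail y

variable {a : (Fin (m + 1) → ℝ) → ℝ}

theorem integral_sublevel (hα : 0 < α) (hp : ∀ i, 0 ≤ p i) (hk : 0 < p k) (T : ℝ) :
    (IntegrableOn a (sublevel α p T) ↔
      IntegrableOn (fun y => A.density α p a y.1 y.2) (A.chartRange α p T)) ∧
    ∫ x in sublevel α p T, a x =
      ∫ y in A.chartRange α p T, A.density α p a y.1 y.2 := by
  set D := openOrthant (m + 1) ∩ sublevel α p T with hD
  have hDm : MeasurableSet D :=
    (isOpen_openOrthant _).measurableSet.inter (measurableSet_sublevel hα hp T)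
  -- The boundary of the orthant, where q need not be differentiable, is a null set.
  have hDae : D =ᵐ[volume] sublevel α p T := by
    have h := (orthant_ae_eq_openOrthant (m + 1)).inter
      (Filter.EventuallyEq.refl (ae volume) (sublevel α p T))
    have hsub : sublevel α p T ⊆ orthant (m + 1) := fun x hx => hx.1
    rwa [inter_eq_self_of_subset_right hsub] at h
  set e := MeasurableEquiv.piFinSuccAbove (fun _ : Fin (m + 1) => ℝ) 0 with he
  have hpres : MeasurePreserving e volume volume :=
    volume_preserving_piFinSuccAbove (fun _ : Fin (m + 1) => ℝ) 0
  have hderiv : ∀ x ∈ D, HasFDerivWithinAt (A.chart α p) (A.consProj (dCes α p x)) D x :=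
    fun x hx => (A.hasFDerivAt_chart hα hp hk hx.1).hasFDerivWithinAt
  have hinj : InjOn (A.chart α p) D := (A.injOn_chart hα hp hk).mono fun x hx => hx.2.1
  set G : ℝ × (Fin m → ℝ) → ℝ := fun y => A.density α p a y.1 y.2 with hG
  have hpull : ∀ x ∈ D, |(A.consProj (dCes α p x)).det| • (G ∘ e) (A.chart α p x) = a x := by
    intro x hx
    have hpos := dCes_single_pos hα hp hk hx.1
    have hGe : (G ∘ e) (A.chart α p x) = A.density α p a (cesProd α p x) (A.proj x) := rfl
    rw [hGe, A.density_proj hα hp hk a hx.2.1, A.det_consProj, abs_of_pos hpos, smul_eq_mul,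
      mul_inv_cancel_left₀ hpos.ne']
  constructor
  · rw [← integrableOn_congr_set_ae hDae, ← hpres.integrableOn_comp_preimage e.measurableEmbedding,
      ← A.image_chart hα hp hk T,
      integrableOn_image_iff_integrableOn_abs_det_fderiv_smul volume hDm hderiv hinj]
    exact (integrableOn_congr_fun hpull hDm).symm
  · rw [← setIntegral_congr_set hDae, ← hpres.setIntegral_preimage_emb e.measurableEmbedding,
      ← A.image_chart hα hp hk T]
    change _ = ∫ x in _, (G ∘ e) x
    rw [integral_image_eq_integral_abs_det_fderiv_smul volume hDm hderiv hinj]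
    exact (setIntegral_congr_fun hDm hpull).symm

end AxisProjection

/-! ### Disintegration and the distributional derivative -/

variable {p : Fin (m + 1) → ℝ} {a : (Fin (m + 1) → ℝ) → ℝ}
  {Ω : (Fin (m + 1) → ℝ) → (Fin (m + 1) → ℝ) [⋀^Fin m]→L[ℝ] ℝ}

/-- Disintegration of the density along the level hypersurfaces. -/
theorem integral_sublevel_eq_levelIntegral {k : Fin (m + 1)} (hα : 0 < α) (hp : ∀ i, 0 ≤ p i) (hk : 0 < p k)
    (hΩ : IsLerayForm α p Ω) {T : ℝ} (ha : IntegrableOn a (sublevel α p T)) :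
    (∀ᵐ s : ℝ, s ∈ Ioc 0 T → LevelIntegrable α p a Ω s) ∧
    IntegrableOn (levelIntegral α p a Ω) (Ioc 0 T) ∧
    ∫ x in sublevel α p T, a x = ∫ s in Ioc 0 T, levelIntegral α p a Ω s := by
  obtain ⟨A⟩ := exists_axisProjection k
  obtain ⟨h1, h2⟩ := A.integral_sublevel (a := a) hα hp hk T
  have hE := A.measurableSet_chartRange hα p T
  set f := (A.chartRange α p T).indicator fun y => A.density α p a y.1 y.2 with hf
  have hint : Integrable f (volume.prod volume) := (integrable_indicator_iff hE).mpr (h1.mp ha)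
  have hfs : ∀ s ∈ Ioc 0 T, (fun v => f (s, v)) =
      (A.domain α p s).indicator (A.density α p a s) := by
    intro s hs
    ext v
    by_cases hv : v ∈ A.domain α p s
    · have : (s, v) ∈ A.chartRange α p T := ⟨hs, hv⟩
      simp [hf, this, hv]
    · have : (s, v) ∉ A.chartRange α p T := fun h => hv h.2
      simp [hf, this, hv]
  have hfs' : ∀ s ∉ Ioc 0 T, (fun v => f (s, v)) = 0 := by
    intro s hs
    ext v
    have : (s, v) ∉ A.chartRange α p T := fun h => hs h.1
    simp [hf, this]
  -- The inner Fubini integral is the level integral, extended by zero outside (0, T].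
  have hF : (fun s => ∫ v, f (s, v)) = (Ioc 0 T).indicator (levelIntegral α p a Ω) := by
    ext s
    by_cases hs : s ∈ Ioc 0 T
    · rw [hfs s hs, indicator_of_mem hs, integral_indicator (A.isOpen_domain hα p s).measurableSet,
        A.levelIntegral_eq hα hp hk hΩ a hs.1]
    · rw [hfs' s hs, indicator_of_notMem hs]
      exact integral_zero _ _
  refine ⟨?_, ?_, ?_⟩
  · filter_upwards [hint.prod_right_ae] with s hs hsT
    rw [hfs s hsT, integrable_indicator_iff (A.isOpen_domain hα p s).measurableSet] at hs
    exact (A.levelIntegrable_iff hα hp hk hΩ a hsT.1).mpr hs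
  · rw [← integrable_indicator_iff measurableSet_Ioc, ← hF]
    exact hint.integral_prod_left
  · rw [h2, ← integral_indicator hE, ← integral_indicator measurableSet_Ioc, ← hF]
    exact integral_prod _ hint

theorem locallyIntegrableOn_halfLine {F : ℝ → ℝ} (hF : ∀ T, 0 < T → IntegrableOn F (Ioc 0 T)) :
    LocallyIntegrableOn F (Ioi 0) := by
  intro x hx
  refine ⟨Ioc 0 (x + 1), ?_, hF _ (by have := mem_Ioi.mp hx; linarith)⟩
  rw [← Ioi_inter_Iic]
  exact inter_mem_nhdsWithin _ (Iic_mem_nhds (by linarith))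

theorem regularDistribution_apply {g : ℝ → ℝ} (hg : LocallyIntegrableOn g (Ioi 0))
    (f : 𝓓(halfLine, ℝ)) : regularDistribution g f = ∫ s, f s * g s :=
  TestFunction.integralAgainstBilinCLM_eq_integral (Ω := halfLine) hg

/-- The distributional derivative of a primitive. -/
theorem lineDeriv_regularDistribution {F V : ℝ → ℝ} (hF : ∀ T, 0 < T → IntegrableOn F (Ioc 0 T))
    (hV : ∀ s, 0 < s → V s = ∫ t in Ioc 0 s, F t) :
    ∂_{(1 : ℝ)} (regularDistribution V) = regularDistribution F := by
  have hFloc := locallyIntegrableOn_halfLine hF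
  set G : ℝ → ℝ := fun s => ∫ t in (0 : ℝ)..s, F t with hG
  have hVG : ∀ s, 0 < s → V s = G s := fun s hs => by
    simp only [hV s hs, hG, intervalIntegral.integral_of_le hs.le]
  have hFi : ∀ T, 0 < T → IntervalIntegrable F volume 0 T := fun T hT =>
    (intervalIntegrable_iff_integrableOn_Ioc_of_le hT.le).mpr (hF T hT)
  have hGac : ∀ T, 0 < T → AbsolutelyContinuousOnInterval G 0 T := fun T hT =>
    (hFi T hT).absolutelyContinuousOnInterval_intervalIntegral (by simp)
  -- Local integrability is what lets the pairing with V be written as an integral.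
  have hVloc : LocallyIntegrableOn V (Ioi 0) := by
    refine locallyIntegrableOn_halfLine fun T hT => ?_
    have h : IntegrableOn G (Ioc 0 T) :=
      (intervalIntegrable_iff_integrableOn_Ioc_of_le hT.le).mp
        (hGac T hT).continuousOn.intervalIntegrable
    exact h.congr_fun (fun s hs => (hVG s hs.1).symm) measurableSet_Ioc
  ext f
  rw [Distribution.lineDerivOp_apply_apply, map_neg, regularDistribution_apply hFloc,
    regularDistribution_apply hVloc]
  have hf' : ∀ s, (∂_{(1 : ℝ)} f : 𝓓(halfLine, ℝ)) s = deriv f s := fun s =>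
    (TestFunction.lineDerivCLM_apply_of_le (𝕜 := ℝ) le_top).trans (by
      simp [lineDeriv, deriv_comp_const_add])
  obtain ⟨T, hT⟩ := f.hasCompactSupport.isCompact.isBounded.bddAbove
  -- The support of f lies strictly inside (0, S), so the boundary terms of the integration by parts
  -- vanish.
  set S : ℝ := max T 0 + 1 with hS
  have hS0 : 0 < S := by positivity
  have hsub : tsupport f ⊆ Ioo 0 S := fun s hs =>
    ⟨f.tsupport_subset hs, lt_of_le_of_lt ((hT hs).trans (le_max_left T 0)) (lt_add_one _)⟩
  have hfS : ∀ s ∉ Ioo 0 S, f s = 0 := fun s hs => image_eq_zero_of_notMem_tsupport fun h =>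
    hs (hsub h)
  have hdS : ∀ s ∉ Ioo 0 S, deriv f s = 0 := fun s hs => by
    by_contra h
    exact hs (hsub (support_deriv_subset h))
  have hfac : AbsolutelyContinuousOnInterval f 0 S :=
    (f.contDiff.of_le (by simp)).contDiffOn.absolutelyContinuousOnInterval
  have hparts := (hGac S hS0).integral_mul_deriv_eq_deriv_mul hfac
  rw [hfS S (by simp), hfS 0 (by simp), mul_zero, mul_zero, sub_zero, zero_sub] at hparts
  have hl : ∫ s, (∂_{(1 : ℝ)} f : 𝓓(halfLine, ℝ)) s * V s = ∫ s in (0 : ℝ)..S, G s * deriv f s := by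
    rw [intervalIntegral.integral_of_le hS0.le, ← integral_indicator measurableSet_Ioc]
    refine integral_congr_ae (Filter.Eventually.of_forall fun s => ?_)
    simp only [hf']
    by_cases hs : s ∈ Ioc 0 S
    · rw [indicator_of_mem hs, hVG s hs.1, mul_comm]
    · rw [indicator_of_notMem hs, hdS s fun h => hs (Ioo_subset_Ioc_self h), zero_mul]
  have hr : ∫ s, f s * F s = ∫ s in (0 : ℝ)..S, deriv G s * f s := by
    -- F is only integrable, so G' = F holds merely almost everywhere, by Lebesgue differentiation.
    have h1 : ∫ s in (0 : ℝ)..S, deriv G s * f s = ∫ s in (0 : ℝ)..S, F s * f s := by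
      refine intervalIntegral.integral_congr_ae ?_
      filter_upwards [(hFi S hS0).ae_hasDerivAt_integral] with s hs hsS
      rw [(hs (uIoc_subset_uIcc hsS) 0 (by simp)).deriv]
    rw [h1, intervalIntegral.integral_of_le hS0.le, ← integral_indicator measurableSet_Ioc]
    refine integral_congr_ae (Filter.Eventually.of_forall fun s => ?_)
    by_cases hs : s ∈ Ioc 0 S
    · simp only [indicator_of_mem hs, mul_comm]
    · simp only [indicator_of_notMem hs, hfS s fun h => hs (Ioo_subset_Ioc_self h), zero_mul]
  rw [hl, hr, hparts, neg_neg]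

/-! ### Homogeneity and reduction to level 1 -/

open scoped Pointwise

theorem cesProd_smul {n : ℕ} (hα : 0 < α) {p x : Fin n → ℝ} (hp : ∀ i, 0 ≤ p i)
    (hx : x ∈ orthant n) {s : ℝ} (hs : 0 ≤ s) : cesProd α p (s • x) = s * cesProd α p x := by
  have hsx : ∀ i, 0 ≤ (s • x) i := fun i => mul_nonneg hs (hx i)
  have hsum : ∑ i, (p i * (s • x) i) ^ α = s ^ α * ∑ i, (p i * x i) ^ α := by
    rw [Finset.mul_sum]
    refine Finset.sum_congr rfl fun i _ => ?_
    rw [← Real.mul_rpow hs (mul_nonneg (hp i) (hx i)), Pi.smul_apply, smul_eq_mul, mul_left_comm]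
  rw [cesProd_eq hα p x hp hx, cesProd_eq hα p _ hp hsx, hsum, Real.mul_rpow (Real.rpow_nonneg hs α)
    (Finset.sum_nonneg fun i _ => Real.rpow_nonneg (mul_nonneg (hp i) (hx i)) α),
    ← Real.rpow_mul hs, mul_one_div_cancel hα.ne', Real.rpow_one]

theorem mul_le_cesProd {n : ℕ} (hα : 0 < α) {p x : Fin n → ℝ} (hp : ∀ i, 0 ≤ p i)
    (hx : x ∈ orthant n) (i : Fin n) : p i * x i ≤ cesProd α p x := by
  have hpx : ∀ i, 0 ≤ p i * x i := fun i => mul_nonneg (hp i) (hx i)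
  rw [← Real.rpow_le_rpow_iff (hpx i) (cesProd_nonneg hα hp hx) hα, cesProd_rpow hα hp hx]
  exact Finset.single_le_sum (f := fun i => (p i * x i) ^ α)
    (fun j _ => Real.rpow_nonneg (hpx j) α) (Finset.mem_univ i)

theorem smul_mem_levelHypersurface {n : ℕ} (hα : 0 < α) {p x : Fin n → ℝ} (hp : ∀ i, 0 ≤ p i)
    {s t : ℝ} (hs : 0 < s) (hx : x ∈ levelHypersurface α p t) :
    s • x ∈ levelHypersurface α p (s * t) :=
  ⟨fun i => mul_pos hs (hx.1 i), by rw [cesProd_smul hα hp (fun i => (hx.1 i).le) hs.le, hx.2]⟩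

namespace AxisProjection

variable {k : Fin (m + 1)} (A : AxisProjection k) {p : Fin (m + 1) → ℝ}
  {Ω : (Fin (m + 1) → ℝ) → (Fin (m + 1) → ℝ) [⋀^Fin m]→L[ℝ] ℝ}
  {a : (Fin (m + 1) → ℝ) → ℝ}

theorem smul_mem_domain (hα : 0 < α) (hp : ∀ i, 0 ≤ p i) (hk : 0 < p k) {s t : ℝ} (hs : 0 < s)
    (ht : 0 < t) {v : Fin m → ℝ} (hv : v ∈ A.domain α p t) :
    s • v ∈ A.domain α p (s * t) ∧ A.graph α p (s * t) (s • v) = s • A.graph α p t v := by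
  obtain ⟨hx, hxs⟩ := smul_mem_levelHypersurface hα hp hs
    (A.graph_mem_levelHypersurface hα hp hk ht hv)
  have hproj : A.proj (s • A.graph α p t v) = s • v := by rw [map_smul, A.proj_graph]
  constructor
  · simpa only [hproj, hxs] using A.proj_mem_domain hα hp hk hx
  · simpa only [hproj, hxs] using A.graph_proj hα hp hk (openOrthant_subset_orthant _ hx)

theorem domain_eq_smul (hα : 0 < α) (hp : ∀ i, 0 ≤ p i) (hk : 0 < p k) {s : ℝ} (hs : 0 < s) :
    A.domain α p s = s • A.domain α p 1 := by
  ext v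
  rw [mem_smul_set_iff_inv_smul_mem₀ hs.ne']
  constructor <;> intro hv
  · simpa [hs.ne'] using (A.smul_mem_domain hα hp hk (inv_pos.mpr hs) hs hv).1
  · simpa [smul_smul, hs.ne'] using (A.smul_mem_domain hα hp hk hs one_pos hv).1

/-- The density in homogeneous coordinates. -/
noncomputable def unitDensity (α : ℝ) (p : Fin (m + 1) → ℝ) (a : (Fin (m + 1) → ℝ) → ℝ) (s : ℝ)
    (v : Fin m → ℝ) : ℝ :=
  (p k ^ α)⁻¹ * A.graph α p 1 v k ^ (1 - α) * a (s • A.graph α p 1 v)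

/-- ∂q/∂x_k is homogeneous of degree 0 and q = 1 on the unit level, so the powers of s cancel and s
survives only in the argument of a. -/
theorem density_smul (hα : 0 < α) (hp : ∀ i, 0 ≤ p i) (hk : 0 < p k) {s : ℝ} (hs : 0 < s)
    {v : Fin m → ℝ} (hv : v ∈ A.domain α p 1) :
    A.density α p a s (s • v) = A.unitDensity α p a s v := by
  have hgraph := (A.smul_mem_domain hα hp hk hs one_pos hv).2
  have hlevel := A.graph_mem_levelHypersurface hα hp hk one_pos hv
  obtain ⟨hx, hxs⟩ := smul_mem_levelHypersurface hα hp hs hlevel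
  rw [mul_one] at hgraph hxs
  have hpos := hlevel.1 k
  rw [density, hgraph, dCes_single hα hp hk hx, hxs, unitDensity, Pi.smul_apply, smul_eq_mul,
    Real.mul_rpow hs.le hpos.le]
  have h1 : s ^ (α - 1) * s ^ (1 - α) = 1 := by
    rw [← Real.rpow_add hs]; simp
  have h2 : (A.graph α p 1 v k ^ (α - 1))⁻¹ = A.graph α p 1 v k ^ (1 - α) := by
    rw [← Real.rpow_neg hpos.le, neg_sub]
  rw [← h2, ← mul_inv]
  congr 2
  linear_combination (p k ^ α * A.graph α p 1 v k ^ (α - 1)) * h1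

theorem integral_density_eq (hα : 0 < α) (hp : ∀ i, 0 ≤ p i) (hk : 0 < p k) {s : ℝ}
    (hs : 0 < s) :
    (IntegrableOn (A.density α p a s) (A.domain α p s) ↔
      IntegrableOn (A.unitDensity α p a s) (A.domain α p 1)) ∧
    ∫ v in A.domain α p s, A.density α p a s v =
      s ^ m * ∫ v in A.domain α p 1, A.unitDensity α p a s v := by
  have hm1 := (A.isOpen_domain hα p 1).measurableSet
  have hms := (A.isOpen_domain hα p s).measurableSet
  constructor
  · rw [← integrable_indicator_iff hms, ← integrable_indicator_iff hm1,
      ← integrable_comp_smul_iff volume _ hs.ne']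
    refine iff_of_eq (congrArg (fun f => Integrable f volume) (funext fun v => ?_))
    have hiff : s • v ∈ A.domain α p s ↔ v ∈ A.domain α p 1 := by
      rw [A.domain_eq_smul hα hp hk hs, smul_mem_smul_set_iff₀ hs.ne']
    by_cases hv : v ∈ A.domain α p 1
    · rw [indicator_of_mem hv, indicator_of_mem (hiff.mpr hv), A.density_smul hα hp hk hs hv]
    · rw [indicator_of_notMem hv, indicator_of_notMem (mt hiff.mp hv)]
  · have h := Measure.setIntegral_comp_smul_of_pos volume (A.density α p a s) (A.domain α p 1) hs
    rw [← A.domain_eq_smul hα hp hk hs, Module.finrank_fin_fun, smul_eq_mul] at h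
    rw [← setIntegral_congr_fun hm1 fun v hv => A.density_smul hα hp hk hs hv, h,
      mul_inv_cancel_left₀ (pow_pos hs m).ne']

/-- Each p_i x_i is at most q(x) = 1; positivity of every p_i turns this into boundedness of the
unit level. -/
theorem graph_mem_Icc (hα : 0 < α) (hp : ∀ i, 0 < p i) {v : Fin m → ℝ}
    (hv : v ∈ A.domain α p 1) : A.graph α p 1 v ∈ Icc 0 fun i => 1 / p i := by
  obtain ⟨hx, hx1⟩ := A.graph_mem_levelHypersurface hα (fun i => (hp i).le) (hp k) one_pos hv
  refine ⟨fun i => (hx i).le, fun i => ?_⟩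
  rw [le_div_iff₀' (hp i)]
  refine le_of_le_of_eq ?_ hx1
  exact mul_le_cesProd hα (fun i => (hp i).le) (openOrthant_subset_orthant _ hx) i

theorem volume_domain_lt_top (hα : 0 < α) (hp : ∀ i, 0 < p i) :
    volume (A.domain α p 1) < ⊤ := by
  have hsub : A.domain α p 1 ⊆ A.proj '' Icc 0 fun i => 1 / p i := fun v hv =>
    ⟨_, A.graph_mem_Icc hα hp hv, A.proj_graph p 1 v⟩
  exact (measure_mono hsub).trans_lt (isCompact_Icc.image A.proj.continuous).measure_lt_top

theorem continuousOn_unitDensity (hα : 0 < α) (hp : ∀ i, 0 ≤ p i) (hk : 0 < p k)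
    (ha : ContinuousOn a (orthant (m + 1))) {s : ℝ} (hs : 0 < s) :
    ContinuousOn (A.unitDensity α p a s) (A.domain α p 1) := by
  have hg : ContinuousOn (A.graph α p 1) (A.domain α p 1) := (A.contDiffOn_graph hp 1).continuousOn
  have hmem := fun v hv => (A.graph_mem_levelHypersurface hα hp hk one_pos (v := v) hv).1
  refine (continuousOn_const.mul (ContinuousOn.rpow_const
    ((continuous_apply k).comp_continuousOn hg) fun v hv => Or.inl (hmem v hv k).ne')).mul
    (ha.comp (hg.const_smul s) fun v hv i => (mul_pos hs (hmem v hv i)).le)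

/-- As 1 - α ≥ 0, the weight x_k^{1-α} is bounded on the box of `graph_mem_Icc`. The points at which
a is evaluated stay in the box dilated by S, which is compact. -/
theorem exists_bound_unitDensity (hα : 0 < α) (hα1 : α ≤ 1) (hp : ∀ i, 0 < p i)
    (ha : ContinuousOn a (orthant (m + 1))) (S : ℝ) :
    ∃ C, ∀ s, 0 < s → s ≤ S → ∀ v ∈ A.domain α p 1, ‖A.unitDensity α p a s v‖ ≤ C := by
  obtain ⟨C, hC⟩ := (isCompact_Icc (a := (0 : Fin (m + 1) → ℝ)) (b := fun i => S * (1 / p i))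
    ).exists_bound_of_continuousOn (ha.mono fun x hx => hx.1)
  refine ⟨(p k ^ α)⁻¹ * (1 / p k) ^ (1 - α) * C, fun s hs hsS v hv => ?_⟩
  obtain ⟨h0, h1⟩ := A.graph_mem_Icc hα hp hv
  have hpk := hp k
  have hk0 : 0 ≤ A.graph α p 1 v k := h0 k
  rw [unitDensity, norm_mul, Real.norm_of_nonneg (by positivity)]
  refine mul_le_mul (mul_le_mul_of_nonneg_left
    (Real.rpow_le_rpow hk0 (h1 k) (by linarith)) (by positivity)) (hC _ ⟨fun i => ?_, fun i => ?_⟩)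
    (norm_nonneg _) (by positivity)
  · exact mul_nonneg hs.le (h0 i)
  · exact mul_le_mul hsS (h1 i) (h0 i) (hs.le.trans hsS)

theorem integrableOn_unitDensity (hα : 0 < α) (hα1 : α ≤ 1) (hp : ∀ i, 0 < p i)
    (ha : ContinuousOn a (orthant (m + 1))) {s : ℝ} (hs : 0 < s) :
    IntegrableOn (A.unitDensity α p a s) (A.domain α p 1) := by
  obtain ⟨C, hC⟩ := A.exists_bound_unitDensity hα hα1 hp ha s
  have hm := (A.isOpen_domain hα p 1).measurableSet
  exact IntegrableOn.of_bound (A.volume_domain_lt_top hα hp)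
    ((A.continuousOn_unitDensity hα (fun i => (hp i).le) (hp k) ha hs).aestronglyMeasurable hm) C
    ((ae_restrict_iff' hm).mpr (Filter.Eventually.of_forall (hC s hs le_rfl)))

theorem continuousOn_integral_unitDensity (hα : 0 < α) (hα1 : α ≤ 1) (hp : ∀ i, 0 < p i)
    (ha : ContinuousOn a (orthant (m + 1))) :
    ContinuousOn (fun s => ∫ v in A.domain α p 1, A.unitDensity α p a s v) (Ioi 0) := by
  intro s₀ hs₀
  -- One constant dominates for all positive s ≤ s₀ + 1, hence near s₀.
  obtain ⟨C, hC⟩ := A.exists_bound_unitDensity hα hα1 hp ha (s₀ + 1)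
  have hm := (A.isOpen_domain hα p 1).measurableSet
  have hpos : ∀ᶠ s in nhdsWithin s₀ (Ioi 0), 0 < s := self_mem_nhdsWithin
  have hle : ∀ᶠ s in nhdsWithin s₀ (Ioi 0), s ≤ s₀ + 1 :=
    nhdsWithin_le_nhds (Iic_mem_nhds (by linarith))
  refine continuousWithinAt_of_dominated (bound := fun _ => C) ?_ ?_ ?_ ?_
  · filter_upwards [hpos] with s hs using (A.integrableOn_unitDensity hα hα1 hp ha hs).1
  · filter_upwards [hpos, hle] with s hs hs'
    exact (ae_restrict_iff' hm).mpr (Filter.Eventually.of_forall (hC s hs hs'))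
  · exact integrableOn_const (A.volume_domain_lt_top hα hp).ne
  · refine (ae_restrict_iff' hm).mpr (Filter.Eventually.of_forall fun v hv => ?_)
    have hx := (A.graph_mem_levelHypersurface hα (fun i => (hp i).le) (hp k) one_pos hv).1
    have hcomp : ContinuousOn (fun s : ℝ => a (s • A.graph α p 1 v)) (Ioi 0) :=
      ha.comp (by fun_prop) fun s hs i => mul_nonneg (le_of_lt hs) (hx i).le
    exact (continuousOn_const.mul hcomp) s₀ hs₀

end AxisProjection

/-! ### Continuity of the level integral and the classical derivative -/

variable {p : Fin (m + 1) → ℝ} {a : (Fin (m + 1) → ℝ) → ℝ}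
  {Ω : (Fin (m + 1) → ℝ) → (Fin (m + 1) → ℝ) [⋀^Fin m]→L[ℝ] ℝ}

theorem levelIntegrable_of_pos (hα : 0 < α) (hα1 : α ≤ 1) (hp : ∀ i, 0 < p i)
    (ha : ContinuousOn a (orthant (m + 1))) (hΩ : IsLerayForm α p Ω) {s : ℝ} (hs : 0 < s) :
    LevelIntegrable α p a Ω s := by
  obtain ⟨A⟩ := exists_axisProjection (0 : Fin (m + 1))
  have hp' := fun i => (hp i).le
  rw [A.levelIntegrable_iff hα hp' (hp 0) hΩ a hs, (A.integral_density_eq hα hp' (hp 0) hs).1]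
  exact A.integrableOn_unitDensity hα hα1 hp ha hs

theorem continuousOn_levelIntegral (hα : 0 < α) (hα1 : α ≤ 1) (hp : ∀ i, 0 < p i)
    (ha : ContinuousOn a (orthant (m + 1))) (hΩ : IsLerayForm α p Ω) :
    ContinuousOn (levelIntegral α p a Ω) (Ioi 0) := by
  obtain ⟨A⟩ := exists_axisProjection (0 : Fin (m + 1))
  have hp' := fun i => (hp i).le
  refine ((continuous_pow m).continuousOn.mul
    (A.continuousOn_integral_unitDensity hα hα1 hp ha)).congr fun s hs => ?_
  rw [A.levelIntegral_eq hα hp' (hp 0) hΩ a hs, (A.integral_density_eq hα hp' (hp 0) hs).2]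
  rfl

/-- Differentiation of the integral of a function continuous on the open half-line. -/
theorem hasDerivAt_of_eq_integral_Ioc {F V : ℝ → ℝ} (hF : ∀ T, 0 < T → IntegrableOn F (Ioc 0 T))
    (hV : ∀ s, 0 < s → V s = ∫ t in Ioc 0 s, F t) (hc : ContinuousOn F (Ioi 0)) {s : ℝ}
    (hs : 0 < s) : HasDerivAt V (F s) s := by
  have h := intervalIntegral.integral_hasDerivAt_right
    ((intervalIntegrable_iff_integrableOn_Ioc_of_le hs.le).mpr (hF s hs))
    (hc.stronglyMeasurableAtFilter isOpen_Ioi s hs) (hc.continuousAt (Ioi_mem_nhds hs))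
  refine h.congr_of_eventuallyEq ?_
  filter_upwards [Ioi_mem_nhds hs] with t ht
  rw [hV t ht, intervalIntegral.integral_of_le (le_of_lt ht)]

end CES

theorem mainTheorem4 (m : ℕ) (α : ℝ) (hα0 : 0 < α) (hα1 : α ≤ 1)
    (μ : CES.SignedBorelMeasure (m + 1)) (a : (Fin (m + 1) → ℝ) → ℝ)
    (ha : ContinuousOn a (CES.orthant (m + 1))) (hμ : μ.HasDensity a)
    (p : Fin (m + 1) → ℝ) (hp : ∀ i, 0 ≤ p i) (hp0 : p ≠ 0)
    (hfin : ∀ s : ℝ, 0 < s → μ.variation (CES.sublevel α p s) < ⊤)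
    (Ω : (Fin (m + 1) → ℝ) → (Fin (m + 1) → ℝ) [⋀^Fin m]→L[ℝ] ℝ)
    (hΩ : CES.IsLerayForm α p Ω) :
    (∀ᵐ s : ℝ, 0 < s → CES.LevelIntegrable α p a Ω s) ∧
    LocallyIntegrableOn (CES.levelIntegral α p a Ω) (Set.Ioi 0) ∧
    CES.radon α μ p = CES.regularDistribution (CES.levelIntegral α p a Ω) ∧
    ((∀ i, 0 < p i) →
      (∀ p₀ : ℝ, 0 < p₀ → CES.LevelIntegrable α p a Ω p₀) ∧
      ContinuousOn (CES.levelIntegral α p a Ω) (Set.Ioi 0) ∧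
      ∀ p₀ : ℝ, 0 < p₀ →
        HasDerivAt (fun s => μ.value (CES.sublevel α p s)) (CES.levelIntegral α p a Ω p₀) p₀) := by
  obtain ⟨k, hk0⟩ := Function.ne_iff.mp hp0
  have hk : 0 < p k := lt_of_le_of_ne (hp k) (Ne.symm hk0)
  have hdens := fun T hT => hμ _ (CES.measurableSet_sublevel hα0 hp T) (fun x hx => hx.1)
    (hfin T hT)
  have hdis := fun T hT => CES.integral_sublevel_eq_levelIntegral hα0 hp hk hΩ (hdens T hT).1
  have hF := fun T hT => (hdis T hT).2.1
  have hV := fun T hT => (hdens T hT).2.trans (hdis T hT).2.2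
  refine ⟨?_, CES.locallyIntegrableOn_halfLine hF, CES.lineDeriv_regularDistribution hF hV,
    fun hpos => ⟨fun s hs => CES.levelIntegrable_of_pos hα0 hα1 hpos ha hΩ hs,
      CES.continuousOn_levelIntegral hα0 hα1 hpos ha hΩ, fun s hs =>
      CES.hasDerivAt_of_eq_integral_Ioc hF hV
        (CES.continuousOn_levelIntegral hα0 hα1 hpos ha hΩ) hs⟩⟩
  -- The exceptional null set depends on T; the countably many intervals (0, N + 1] exhaust the
  -- half-line.
  have hall : ∀ᵐ s : ℝ, ∀ N : ℕ, s ∈ Ioc 0 ((N : ℝ) + 1) → CES.LevelIntegrable α p a Ω s :=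
    ae_all_iff.mpr fun N => (hdis _ (by positivity)).1
  filter_upwards [hall] with s hs hs0
  obtain ⟨N, hN⟩ := exists_nat_ge s
  exact hs N ⟨hs0, by linarith⟩
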